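/- Let $k$ be a number field of degree $d>1$ with ring of integers $\mathfrak{o}$. Let $\Sigma=\mathrm{Hom}(k,\overline{\mathbb{Q}})$, let $K\subset\overline{\mathbb{Q}}$ be the compositum of the fields $\sigma(k)$ for $\sigma\in\Sigma$, and let $G=\mathrm{Gal}(K/\mathbb{Q})$, which acts on $\Sigma$ by $g\sigma:=g\circ\sigma$. Define the tame discriminant of $k$ by $$\Delta_{\mathrm{tame}}:=\prod_p p^{\,d-f_p},\qquad f_p:=\sum_{\mathfrak{p}\mid p}f_{\mathfrak{p}},$$ where $p$ runs over the rational primes, $\mathfrak{p}$ runs over the prime ideals of $\mathfrak{o}$ above $p$, and $f_{\mathfrak{p}}$ is the inertia degree of $\mathfrak{p}$ over $p$. **Theorem.** Let $\mathfrak{n}\subset\mathfrak{o}$ be a nonzero ideal, let $m\in\{1,\dots,d\}$, and let $X\subset\mathfrak{n}$ and $S\subset\Sigma$ be $m$-element subsets. Then $$\prod_{g\in G}{\det}^2\bigl(\sigma(x)\bigr)^{\sigma\in gS}_{x\in X}$$ (where each squared determinant does not depend on the orderings of $gS$ and $X$) is a rational integer, the numbers $|G|\max\left(0,\frac{2m}{d}-1\right)$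 and $|G|\frac{2m}{d}$ are nonnegative integers, and the product is divisible in $\mathbb{Z}$ by $$\Delta_{\mathrm{tame}}^{|G|\max\left(0,\frac{2m}{d}-1\right)}\,[\mathfrak{o}:\mathfrak{n}]^{|G|\frac{2m}{d}}.$$ If moreover $G$ is $2$-homogeneous, that is, $G$ acts transitively on the $2$-element subsets of $\Sigma$, then $|G|\frac{m(m-1)}{d(d-1)}$ is a nonnegative integer, and the product is divisible in $\mathbb{Z}$ by $$\Delta_{\mathrm{tame}}^{|G|\frac{m(m-1)}{d(d-1)}}\,[\mathfrak{o}:\mathfrak{n}]^{|G|\frac{2m}{d}}.$$ -/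

import Mathlib

open scoped NumberField

namespace MinorDivisibility

noncomputable section

/-- `Σ = Hom(k, ℚ̄)`, the set of all embeddings of `k` into the algebraic closure of `ℚ`. -/
abbrev Emb (k : Type*) [Field k] [NumberField k] : Type _ :=
  k →ₐ[ℚ] AlgebraicClosure ℚ

/-- The compositum `K` inside `ℚ̄` of the fields `σ(k)`, for `σ ∈ Σ`. -/
abbrev galoisHull (k : Type*) [Field k] [NumberField k] :
    IntermediateField ℚ (AlgebraicClosure ℚ) :=
  IntermediateField.normalClosure ℚ k (AlgebraicClosure ℚ)

theorem galoisHull_eq (k : Type*) [Field k] [NumberField k] :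
    galoisHull k = ⨆ σ : Emb k, σ.fieldRange :=
  rfl

instance isGalois_galoisHull (k : Type*) [Field k] [NumberField k] :
    IsGalois ℚ (galoisHull k) := by
  have hA : Algebra.IsAlgebraic ℚ (AlgebraicClosure ℚ) := by
    have h := AlgebraicClosure.isAlgebraic ℚ
    rwa [Subsingleton.elim (AlgebraicClosure.instAlgebra ℚ) DivisionRing.toRatAlgebra] at h
  have : IsAlgClosure ℚ (AlgebraicClosure ℚ) := ⟨inferInstance, hA⟩
  have : Normal ℚ (AlgebraicClosure ℚ) := IsAlgClosure.normal ℚ _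
  have hN := normalClosure.normal ℚ k (AlgebraicClosure ℚ)
  have : Normal ℚ (galoisHull k) := by
    rwa [Subsingleton.elim (galoisHull k).algebra' DivisionRing.toRatAlgebra] at hN
  exact ⟨⟩

/-- The Galois group `G = Gal(K/ℚ)`. -/
abbrev galoisGroup (k : Type*) [Field k] [NumberField k] : Type :=
  Gal(galoisHull k/ℚ)

theorem emb_mem_galoisHull {k : Type*} [Field k] [NumberField k] (σ : Emb k) (x : k) :
    σ x ∈ galoisHull k :=
  σ.fieldRange_le_normalClosure ⟨x, rfl⟩

/-- The embedding `σ : k → ℚ̄`, regarded as an embedding of `k` into `K`. -/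
def toHull {k : Type*} [Field k] [NumberField k] (σ : Emb k) : k →ₐ[ℚ] galoisHull k :=
  σ.codRestrict (galoisHull k).toSubalgebra (emb_mem_galoisHull σ)

/-- `G` acts on `Σ` by `g • σ = g ∘ σ`. -/
instance galoisAction (k : Type*) [Field k] [NumberField k] :
    MulAction (galoisGroup k) (Emb k) where
  smul g σ := (galoisHull k).val.comp ((g : galoisHull k →ₐ[ℚ] galoisHull k).comp (toHull σ))
  one_smul _ := rfl
  mul_smul _ _ _ := rfl

theorem galoisAction_apply {k : Type*} [Field k] [NumberField k] (g : galoisGroup k)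
    (σ : Emb k) (x : k) : (g • σ) x = (g (toHull σ x) : AlgebraicClosure ℚ) :=
  rfl

/-- The translate `gS` of a finite set `S ⊆ Σ`. -/
def translate {k : Type*} [Field k] [NumberField k] (g : galoisGroup k)
    (S : Finset (Emb k)) : Finset (Emb k) :=
  S.map (MulAction.toPerm g).toEmbedding

theorem card_translate {k : Type*} [Field k] [NumberField k] (g : galoisGroup k)
    (S : Finset (Emb k)) : (translate g S).card = S.card :=
  Finset.card_map _

/-- `G` is `2`-homogeneous: it acts transitively on the `2`-element subsets of `Σ`. -/
def IsTwoHomogeneous (k : Type*) [Field k] [NumberField k] : Prop :=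
  ∀ T U : Finset (Emb k), T.card = 2 → U.card = 2 → ∃ g : galoisGroup k, translate g T = U

/-- The square of the determinant of `(σ(x))`, with rows `σ ∈ S` and columns `x ∈ X`, where `S`
and `X` both have `m` elements. The rows and the columns are put in some order; the square does
not depend on it, see `detSq_eq`. -/
def detSq {k : Type*} [Field k] [NumberField k] {m : ℕ} (S : Finset (Emb k)) (X : Finset (𝓞 k))
    (hS : S.card = m) (hX : X.card = m) : AlgebraicClosure ℚ :=
  (Matrix.of fun i j : Fin m =>
    ((S.equivFinOfCardEq hS).symm i : Emb k) (((X.equivFinOfCardEq hX).symm j : 𝓞 k) : k)).det ^ 2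

theorem detSq_eq {k : Type*} [Field k] [NumberField k] {m : ℕ} (S : Finset (Emb k))
    (X : Finset (𝓞 k)) (hS : S.card = m) (hX : X.card = m) (s : Fin m ≃ S) (x : Fin m ≃ X) :
    detSq S X hS hX =
      (Matrix.of fun i j : Fin m => (s i : Emb k) ((x j : 𝓞 k) : k)).det ^ 2 := by
  set M := Matrix.of fun i j : Fin m => (s i : Emb k) ((x j : 𝓞 k) : k) with hM
  have h : (Matrix.of fun i j : Fin m =>
      ((S.equivFinOfCardEq hS).symm i : Emb k) (((X.equivFinOfCardEq hX).symm j : 𝓞 k) : k)) =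
      (M.submatrix ((S.equivFinOfCardEq hS).symm.trans s.symm) id).submatrix id
        ((X.equivFinOfCardEq hX).symm.trans x.symm) := by
    ext i j
    simp [hM]
  rw [detSq, h, Matrix.det_permute', Matrix.det_permute, mul_pow, mul_pow]
  simp [← Int.cast_pow, ← Units.val_pow_eq_pow_val]

/-- `f_p`, the sum of the inertia degrees of the prime ideals of `𝓞 k` above `p`. -/
def inertiaSum (k : Type*) [Field k] [NumberField k] (p : ℕ) : ℕ :=
  ∑ P ∈ (Algebra.QuasiFinite.finite_primesOver (S := 𝓞 k) (Ideal.span {(p : ℤ)})).toFinset,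
    P.inertiaDeg ℤ

/-- The tame discriminant `∏ p, p ^ (d - f_p)`, over all primes `p`. Here `f_p ≤ d` for all `p`,
and `f_p = d` for all but finitely many `p`, see `inertiaSum_le` and `finite_tame`. -/
def tameDiscr (k : Type*) [Field k] [NumberField k] : ℕ :=
  ∏ᶠ p : Nat.Primes, (p : ℕ) ^ (Module.finrank ℚ k - inertiaSum k p)

theorem inertiaSum_le (k : Type*) [Field k] [NumberField k] (p : Nat.Primes) :
    inertiaSum k p ≤ Module.finrank ℚ k := by
  classical
  have hp : Prime ((p : ℕ) : ℤ) := Nat.prime_iff_prime_int.mp p.2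
  have : (Ideal.span {((p : ℕ) : ℤ)}).IsPrime :=
    (Ideal.span_singleton_prime hp.ne_zero).mpr hp
  set T := (Algebra.QuasiFinite.finite_primesOver (S := 𝓞 k) (Ideal.span {((p : ℕ) : ℤ)}))
  let := T.fintype
  have h := Ideal.sum_ramification_inertia_eq_finrank (S := 𝓞 k) (Ideal.span {((p : ℕ) : ℤ)})
  rw [NumberField.RingOfIntegers.rank] at h
  rw [← h, inertiaSum, ← Finset.sum_coe_sort, ← Equiv.sum_comp (T.subtypeEquivToFinset)]
  refine Finset.sum_le_sum fun P _ => ?_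
  have := P.2.1
  exact Nat.le_mul_of_pos_left _ (Ideal.ramificationIdx_pos P.1 ℤ)

theorem finite_tame (k : Type*) [Field k] [NumberField k] :
    {p : Nat.Primes | inertiaSum k p ≠ Module.finrank ℚ k}.Finite := by
  classical
  have hfin : {p : Nat.Primes | ((p : ℕ) : ℤ) ∣ NumberField.discr k}.Finite := by
    refine Set.Finite.of_finite_image (f := fun p : Nat.Primes => (p : ℕ)) ?_
      Subtype.val_injective.injOn
    refine (Set.finite_Iic (NumberField.discr k).natAbs).subset ?_
    rintro _ ⟨p, hp, rfl⟩
    exact Nat.le_of_dvd (Int.natAbs_pos.mpr (NumberField.discr_ne_zero k))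
      (Int.natCast_dvd.mp hp)
  refine hfin.subset fun p hp => ?_
  by_contra hdvd
  apply hp
  have hpp : Prime ((p : ℕ) : ℤ) := Nat.prime_iff_prime_int.mp p.2
  have : (Ideal.span {((p : ℕ) : ℤ)}).IsPrime :=
    (Ideal.span_singleton_prime hpp.ne_zero).mpr hpp
  have hun := (NumberField.not_dvd_discr_iff_isUnramifiedIn k (𝓞 k) hpp).mp hdvd
  set T := (Algebra.QuasiFinite.finite_primesOver (S := 𝓞 k) (Ideal.span {((p : ℕ) : ℤ)}))
  let := T.fintype
  have h := Ideal.sum_ramification_inertia_eq_finrank (S := 𝓞 k) (Ideal.span {((p : ℕ) : ℤ)})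
  rw [NumberField.RingOfIntegers.rank] at h
  rw [← h, inertiaSum, ← Finset.sum_coe_sort, ← Equiv.sum_comp (T.subtypeEquivToFinset)]
  refine Finset.sum_congr rfl fun P _ => ?_
  have := P.2.1
  rw [hun.ramificationIdx_eq_one P.2.2, one_mul]
  rfl

end

end MinorDivisibility

/-! Divisibility is tested at one rational prime `p` at a time. Let `P` be a prime of the hull above
`p` with inertia group `I`, let `e_σ` be the ramification index of `P` over `σ(k)`, and let `n_σ` be
the order of `𝔫` at the prime of `k` below `P` along `σ`.

Locally, elements of `𝔫` are expanded in powers of a uniformizer `π` of that prime, with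
coefficients that are `q ^ N`-th powers (`exists_expansion`). Embeddings in one `I`-orbit agree
modulo `P`, so they agree on such coefficients modulo a high power of `P`
(`pow_pow_sub_pow_pow_mem`); within an orbit only the image of `π` varies. Expand the determinant by
rows: a term vanishes if two rows of one orbit use the same coefficient, so `s` rows of an orbit
gain at least `e_σ * (0 + 1 + ... + (s - 1))`. Hence the squared determinant lies in `P` to the
power `2 ∑ e_σ n_σ` plus a weight `e_σ` for each ordered pair of distinct rows in one orbit
(`det_sq_intEmb_mem`).

Over all embeddings, the `e_σ n_σ` sum to `|I|` times the exponent of `p` in the norm of `𝔫`, and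
the pair weights sum to `|I| (d - f_p)` (`sum_sum_embWeight`). Averaging over `G` gives the share of
these totals that falls to `S`: `m / d` for the linear part by transitivity, and `m (m - 1) / (d (d
- 1))` for the pairs under 2-homogeneity. Without it, the inequality `xy ≥ x + y - 1` for indicators
leaves the share `2 m / d - 1`. Finally `|I|` is the ramification index of `P` over `p`, so it
cancels on passing from `P` to `p` (`pow_dvd_of_mem_pow`). -/

namespace MinorDivisibility

/-! ### Averages of functions and pair weights over a group action -/

section Averaging

variable {G α : Type*} [Group G] [Fintype G] [Fintype α] [MulAction G α]

/-- The sum of a function along a transitive action, counted with multiplicity. -/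
theorem card_mul_sum_smul (htrans : ∀ a b : α, ∃ g : G, g • a = b) (f : α → ℕ) (a : α) :
    Fintype.card α * ∑ g : G, f (g • a) = Fintype.card G * ∑ b, f b := by
  have hconst (b : α) : ∑ g : G, f (g • b) = ∑ g : G, f (g • a) := by
    obtain ⟨h, rfl⟩ := htrans a b
    exact Fintype.sum_equiv (Equiv.mulRight h) _ _ fun g => by simp [mul_smul]
  have hinv (g : G) : ∑ b, f (g • b) = ∑ b, f b :=
    Equiv.sum_comp (MulAction.toPerm g) f
  calc Fintype.card α * ∑ g : G, f (g • a) = ∑ b : α, ∑ g : G, f (g • b) := by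
        simp [hconst, Finset.sum_const]
    _ = Fintype.card G * ∑ b, f b := by
        rw [Finset.sum_comm]
        simp [hinv, Finset.sum_const]

theorem card_mul_sum_sum_smul (htrans : ∀ a b : α, ∃ g : G, g • a = b) (f : α → ℕ)
    (S : Finset α) :
    Fintype.card α * ∑ g : G, ∑ a ∈ S, f (g • a) = Fintype.card G * (S.card * ∑ b, f b) := by
  rw [Finset.sum_comm, Finset.mul_sum,
    Finset.sum_congr rfl fun a _ => card_mul_sum_smul htrans f a]
  simp [mul_left_comm]

/-- The sum of a symmetric weight along an action that is transitive on unordered pairs. -/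
theorem card_mul_sum_smul_smul
    (htrans : ∀ a b a' b' : α, a ≠ b → a' ≠ b' →
      ∃ g : G, (g • a = a' ∧ g • b = b') ∨ (g • a = b' ∧ g • b = a'))
    (w : α → α → ℕ) (hdiag : ∀ a, w a a = 0) (hsymm : ∀ a b, w a b = w b a) {a b : α}
    (hab : a ≠ b) :
    Fintype.card α * (Fintype.card α - 1) * ∑ g : G, w (g • a) (g • b) =
      Fintype.card G * ∑ a', ∑ b', w a' b' := by
  classical
  set F := ∑ g : G, w (g • a) (g • b) with hF
  have hconst (a' b' : α) : ∑ g : G, w (g • a') (g • b') = if b' = a' then 0 else F := by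
    split_ifs with h
    · simp [h, hdiag]
    · obtain ⟨k, ⟨rfl, rfl⟩ | ⟨rfl, rfl⟩⟩ := htrans a b a' b' hab (Ne.symm h)
      · exact Fintype.sum_equiv (Equiv.mulRight k) _ _ fun g => by simp [mul_smul]
      -- The pair may arrive in reversed order; symmetry of `w` absorbs this.
      · exact Fintype.sum_equiv (Equiv.mulRight k) _ _ fun g => by
          simp [mul_smul, hsymm (g • k • b)]
  have hinv (g : G) : ∑ a', ∑ b', w (g • a') (g • b') = ∑ a', ∑ b', w a' b' := by
    rw [← Equiv.sum_comp (MulAction.toPerm g) fun a' => ∑ b', w a' b']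
    refine Finset.sum_congr rfl fun a' _ => ?_
    exact Equiv.sum_comp (MulAction.toPerm g) fun b' => w (g • a') b'
  calc Fintype.card α * (Fintype.card α - 1) * F
      = ∑ a' : α, ∑ b' : α, ∑ g : G, w (g • a') (g • b') := by
        simp only [hconst, Finset.sum_ite, Finset.sum_const_zero, Finset.sum_const, zero_add,
          Finset.filter_ne', Finset.card_erase_of_mem (Finset.mem_univ _), Finset.card_univ,
          smul_eq_mul, mul_assoc]
    _ = ∑ g : G, ∑ a' : α, ∑ b' : α, w (g • a') (g • b') := by
        rw [Finset.sum_comm (s := (Finset.univ : Finset G))]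
        exact Finset.sum_congr rfl fun a' _ => Finset.sum_comm
    _ = Fintype.card G * ∑ a', ∑ b', w a' b' := by
        simp [hinv, Finset.sum_const]

theorem card_mul_sum_sum_sum_smul
    (htrans : ∀ a b a' b' : α, a ≠ b → a' ≠ b' →
      ∃ g : G, (g • a = a' ∧ g • b = b') ∨ (g • a = b' ∧ g • b = a'))
    (w : α → α → ℕ) (hdiag : ∀ a, w a a = 0) (hsymm : ∀ a b, w a b = w b a) (S : Finset α) :
    Fintype.card α * (Fintype.card α - 1) *
        ∑ g : G, ∑ a ∈ S, ∑ b ∈ S, w (g • a) (g • b) =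
      Fintype.card G * (S.card * (S.card - 1) * ∑ a', ∑ b', w a' b') := by
  classical
  have hswap : ∑ g : G, ∑ a ∈ S, ∑ b ∈ S, w (g • a) (g • b) =
      ∑ a ∈ S, ∑ b ∈ S, ∑ g : G, w (g • a) (g • b) := by
    rw [Finset.sum_comm]
    exact Finset.sum_congr rfl fun a _ => Finset.sum_comm
  have hpair (a b : α) : Fintype.card α * (Fintype.card α - 1) *
      ∑ g : G, w (g • a) (g • b) =
        if b = a then 0 else Fintype.card G * ∑ a', ∑ b', w a' b' := by
    split_ifs with h
    · simp [h, hdiag]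
    · exact card_mul_sum_smul_smul htrans w hdiag hsymm (Ne.symm h)
  rw [hswap]
  rw [Finset.mul_sum, Finset.sum_congr rfl fun a _ => Finset.mul_sum _ _ _]
  simp only [hpair]
  have hrow (a : α) (ha : a ∈ S) :
      (∑ b ∈ S, if b = a then 0 else Fintype.card G * ∑ a', ∑ b', w a' b') =
        (S.card - 1) * (Fintype.card G * ∑ a', ∑ b', w a' b') := by
    simp [Finset.sum_ite, Finset.filter_ne', Finset.card_erase_of_mem ha]
  rw [Finset.sum_congr rfl hrow, Finset.sum_const, smul_eq_mul]
  ring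

/-- The total weight of the pairs inside a subset is bounded below by a linear expression in its
indicator function. -/
theorem two_mul_sum_sum_le (w : α → α → ℕ) (hsymm : ∀ a b, w a b = w b a) (T : Finset α) :
    2 * ∑ a ∈ T, ∑ b, w a b ≤ (∑ a ∈ T, ∑ b ∈ T, w a b) + ∑ a, ∑ b, w a b := by
  classical
  set x : α → ℕ := fun a => if a ∈ T then 1 else 0 with hx
  have h1 : ∑ a ∈ T, ∑ b, w a b = ∑ a, ∑ b, w a b * x a := by
    simp [hx]
  have h2 : ∑ a ∈ T, ∑ b, w a b = ∑ a, ∑ b, w a b * x b := by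
    rw [h1, Finset.sum_comm]
    simp only [hsymm]
  have h3 : ∑ a ∈ T, ∑ b ∈ T, w a b = ∑ a, ∑ b, w a b * (x a * x b) := by
    simp [hx]
  rw [two_mul]
  nth_rewrite 1 [h1]
  rw [h2, h3]
  simp only [← Finset.sum_add_distrib]
  refine Finset.sum_le_sum fun a _ => Finset.sum_le_sum fun b _ => ?_
  -- Termwise this is `x a + x b ≤ x a * x b + 1` for values in `{0, 1}`.
  by_cases ha : a ∈ T <;> by_cases hb : b ∈ T <;> simp [hx, ha, hb]

end Averaging

/-! ### Divisibility of determinants with rows grouped in classes -/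

section Determinant

variable {ι γ : Type*}

open Classical in
/-- The weight of a pair: `ε i` if `i` and `j` are distinct members of one class, else `0`. -/
noncomputable def pairWeight (cl : ι → γ) (ε : ι → ℕ) (i j : ι) : ℕ :=
  if j ≠ i ∧ cl j = cl i then ε i else 0

theorem pairWeight_self (cl : ι → γ) (ε : ι → ℕ) (i : ι) : pairWeight cl ε i i = 0 := by
  simp [pairWeight]

theorem pairWeight_comm {cl : ι → γ} {ε : ι → ℕ} (hε : ∀ i j, cl i = cl j → ε i = ε j)
    (i j : ι) : pairWeight cl ε i j = pairWeight cl ε j i := by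
  have hiff : (j ≠ i ∧ cl j = cl i) ↔ (i ≠ j ∧ cl i = cl j) :=
    ⟨fun h => ⟨h.1.symm, h.2.symm⟩, fun h => ⟨h.1.symm, h.2.symm⟩⟩
  unfold pairWeight
  split_ifs with h h' h'
  · exact hε i j h'.2
  · exact absurd (hiff.mp h) h'
  · exact absurd (hiff.mpr h') h
  · rfl

open Classical in
theorem pairWeight_comp {κ : Type*} {s : κ → ι} (hs : Function.Injective s) (cl : ι → γ)
    (ε : ι → ℕ) (i j : κ) :
    pairWeight cl ε (s i) (s j) = pairWeight (fun i => cl (s i)) (fun i => ε (s i)) i j := by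
  unfold pairWeight
  simp only [hs.ne_iff]

/-- The added `ε i` stands for the missing diagonal term and avoids a subtraction. -/
theorem sum_pairWeight_add [Fintype ι] (cl : ι → γ) (ε : ι → ℕ) (i : ι) :
    (∑ j, pairWeight cl ε i j) + ε i = Nat.card {j // cl j = cl i} * ε i := by
  classical
  have hmem : i ∈ Finset.univ.filter fun j => cl j = cl i := by simp
  have h : ∑ j, pairWeight cl ε i j =
      ((Finset.univ.filter fun j => cl j = cl i).erase i).card * ε i := by
    unfold pairWeight
    rw [← Finset.sum_filter, Finset.sum_const, smul_eq_mul]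
    congr 2
    ext j
    simp
  rw [h, ← Nat.succ_mul, Nat.succ_eq_add_one, Finset.card_erase_add_one hmem,
    Nat.card_eq_fintype_card, Fintype.card_subtype]

/-- Charge each pair to its member with the larger value of `f`. Since `f` is injective on classes,
at most `f i` members of the class of `i` have a smaller value; the factor 2 counts both orders of a
pair. -/
theorem sum_pairWeight_le [Fintype ι] {cl : ι → γ} {ε : ι → ℕ} (hε : ∀ i j, cl i = cl j → ε i = ε j)
    (f : ι → ℕ) (hf : ∀ i j, cl i = cl j → f i = f j → i = j) :
    ∑ i, ∑ j, pairWeight cl ε i j ≤ 2 * ∑ i, ε i * f i := by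
  classical
  have hsplit (i j : ι) : pairWeight cl ε i j ≤
      (if cl j = cl i ∧ f j < f i then ε i else 0) +
        if cl i = cl j ∧ f i < f j then ε j else 0 := by
    unfold pairWeight
    by_cases h : j ≠ i ∧ cl j = cl i
    · rcases lt_trichotomy (f i) (f j) with hlt | heq | hlt
      · simp [h.1, h.2, hlt, hε j i h.2]
      · exact absurd (hf i j h.2.symm heq).symm h.1
      · simp [h.1, h.2, hlt]
    · simp [h]
  have hone (i : ι) : (∑ j, if cl j = cl i ∧ f j < f i then ε i else 0) ≤ ε i * f i := by
    rw [← Finset.sum_filter, Finset.sum_const, smul_eq_mul, mul_comm]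
    refine Nat.mul_le_mul_left _ ?_
    rw [← Finset.card_range (f i)]
    refine Finset.card_le_card_of_injOn f (fun j hj => ?_) fun j hj j' hj' h => ?_
    · simpa using (Finset.mem_filter.mp hj).2.2
    · exact hf j j' ((Finset.mem_filter.mp hj).2.1.trans (Finset.mem_filter.mp hj').2.1.symm) h
  calc ∑ i, ∑ j, pairWeight cl ε i j
      ≤ ∑ i, ∑ j, ((if cl j = cl i ∧ f j < f i then ε i else 0) +
        if cl i = cl j ∧ f i < f j then ε j else 0) :=
        Finset.sum_le_sum fun i _ => Finset.sum_le_sum fun j _ => hsplit i j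
    _ = 2 * ∑ i, ∑ j, if cl j = cl i ∧ f j < f i then ε i else 0 := by
        simp only [Finset.sum_add_distrib, two_mul]
        congr 1
        exact Finset.sum_comm
    _ ≤ 2 * ∑ i, ε i * f i :=
        Nat.mul_le_mul_left _ (Finset.sum_le_sum fun i _ => hone i)

variable [Fintype ι] [DecidableEq ι] {R : Type*} [CommRing R]

theorem det_sub_det_mem (I : Ideal R) (M M' : Matrix ι ι R) (h : ∀ i j, M i j - M' i j ∈ I) :
    M.det - M'.det ∈ I := by
  rw [← Ideal.Quotient.eq, RingHom.map_det, RingHom.map_det]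
  congr 1
  ext i j
  exact Ideal.Quotient.eq.mpr (h i j)

/-- A determinant whose rows have expansions in powers of `ϖ i`, with coefficients that depend
on the class of the row only, is highly divisible. -/
theorem det_sum_mem_pow (P : Ideal R) {cl : ι → γ} {ε n : ι → ℕ}
    (hε : ∀ i j, cl i = cl j → ε i = ε j) (L : ℕ) (ϖ : ι → R) (hϖ : ∀ i, ϖ i ∈ P ^ ε i)
    (A : γ → ℕ → ι → R) (C : ℕ)
    (hC : 2 * C ≤ (∑ i, 2 * (ε i * n i)) + (∑ i, ∑ j, pairWeight cl ε i j) + 1) :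
    (Matrix.of fun i x => ∑ j ∈ Finset.range L, ϖ i ^ (n i + j) * A (cl i) j x).det ∈
      P ^ C := by
  have hrow : (Matrix.of fun i x => ∑ j ∈ Finset.range L, ϖ i ^ (n i + j) * A (cl i) j x) =
      fun i => ∑ j ∈ Finset.range L, ϖ i ^ (n i + j) • A (cl i) j := by
    ext i x
    simp [Finset.sum_apply]
  have hexp := MultilinearMap.map_sum_finset
    (Matrix.detRowAlternating (n := ι) (R := R)).toMultilinearMap
    (fun i j => ϖ i ^ (n i + j) • A (cl i) j) fun _ => Finset.range L
  simp only [AlternatingMap.coe_multilinearMap] at hexp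
  rw [hrow]
  change Matrix.detRowAlternating _ ∈ _
  rw [hexp]
  refine Ideal.sum_mem _ fun f _ => ?_
  rw [← AlternatingMap.coe_multilinearMap, MultilinearMap.map_smul_univ, smul_eq_mul,
    AlternatingMap.coe_multilinearMap]
  -- Either the choice `f` separates the rows of each class, and `sum_pairWeight_le` bounds the
  -- exponent from below, or two of the chosen coefficient rows coincide and the term vanishes.
  by_cases hf : ∀ i j, cl i = cl j → f i = f j → i = j
  · refine Ideal.mul_mem_right _ _ (Ideal.pow_le_pow_right (n := ∑ i, ε i * (n i + f i)) ?_ ?_)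
    · have := sum_pairWeight_le hε f hf
      simp only [mul_add, Finset.sum_add_distrib, ← Finset.mul_sum] at this hC ⊢
      omega
    · rw [← Finset.prod_pow_eq_pow_sum]
      refine Ideal.prod_mem_prod fun i _ => ?_
      rw [pow_mul]
      exact Ideal.pow_mem_pow (hϖ i) _
  · push Not at hf
    obtain ⟨i, j, hcl, hfij, hij⟩ := hf
    rw [AlternatingMap.map_eq_zero_of_eq _ _ (by simp [hcl, hfij]) hij, mul_zero]
    exact zero_mem _

theorem det_sq_mem_pow (P : Ideal R) {cl : ι → γ} {ε n : ι → ℕ}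
    (hε : ∀ i j, cl i = cl j → ε i = ε j) (B L : ℕ)
    (hB : B = (∑ i, 2 * (ε i * n i)) + ∑ i, ∑ j, pairWeight cl ε i j)
    (ϖ : ι → R) (hϖ : ∀ i, ϖ i ∈ P ^ ε i) (A : γ → ℕ → ι → R) (M : Matrix ι ι R)
    (hM : ∀ i x, M i x - ∑ j ∈ Finset.range L, ϖ i ^ (n i + j) * A (cl i) j x ∈ P ^ B) :
    M.det ^ 2 ∈ P ^ B := by
  -- The exponent for the determinant is an integer at least `B / 2`, so it may be rounded up and
  -- squaring loses nothing. An error in `P ^ B` is harmless at this precision.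
  have h1 := det_sum_mem_pow (n := n) P hε L ϖ hϖ A ((B + 1) / 2) (by omega)
  have h2 := Ideal.pow_le_pow_right (I := P) (show (B + 1) / 2 ≤ B by omega)
    (det_sub_det_mem (P ^ B) M
      (Matrix.of fun i x => ∑ j ∈ Finset.range L, ϖ i ^ (n i + j) * A (cl i) j x) hM)
  have h3 : M.det ∈ P ^ ((B + 1) / 2) := by simpa using add_mem h2 h1
  refine Ideal.pow_le_pow_right (show B ≤ (B + 1) / 2 * 2 by omega) ?_
  rw [pow_mul]
  exact Ideal.pow_mem_pow h3 2

end Determinant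

/-! ### Expansions at a prime with high powers as coefficients -/

section Expansion

/-- The cofactor of `a - b` in `a ^ q - b ^ q` is a sum of `q` terms, all congruent to `b ^ (q - 1)`
modulo `P`; as `q ∈ P`, it contributes one more factor `P`. -/
theorem pow_sub_pow_mem_pow_succ {R : Type*} [CommRing R] (P : Ideal R) {q i : ℕ} (hi : i ≠ 0)
    (hq : (q : R) ∈ P) {a b : R} (hab : a - b ∈ P ^ i) : a ^ q - b ^ q ∈ P ^ (i + 1) := by
  rw [← (Commute.all a b).mul_geom_sum₂, pow_succ]
  refine Ideal.mul_mem_mul hab ?_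
  have h : Ideal.Quotient.mk P a = Ideal.Quotient.mk P b :=
    Ideal.Quotient.eq.mpr (Ideal.pow_le_self hi hab)
  rw [← Ideal.Quotient.eq_zero_iff_mem, map_sum]
  have hq' : (q : R ⧸ P) = 0 := by
    simpa using Ideal.Quotient.eq_zero_iff_mem.mpr hq
  have hterm (j : ℕ) (hj : j ∈ Finset.range q) :
      Ideal.Quotient.mk P (a ^ j * b ^ (q - 1 - j)) = Ideal.Quotient.mk P b ^ (q - 1) := by
    rw [map_mul, map_pow, map_pow, h, ← pow_add]
    congr 1
    have := Finset.mem_range.mp hj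
    omega
  rw [Finset.sum_congr rfl hterm]
  simp [hq']

theorem pow_pow_sub_pow_pow_mem {R : Type*} [CommRing R] (P : Ideal R) {q : ℕ}
    (hq : (q : R) ∈ P) {a b : R} (hab : a - b ∈ P) (N : ℕ) :
    a ^ q ^ N - b ^ q ^ N ∈ P ^ (N + 1) := by
  induction N with
  | zero => simpa using hab
  | succ N ih =>
    rw [pow_succ q, pow_mul, pow_mul]
    exact pow_sub_pow_mem_pow_succ P N.succ_ne_zero hq ih

/-- An expansion in powers of a uniformizer whose coefficients are `q ^ N`-th powers. -/
theorem exists_expansion {R : Type*} [CommRing R] [IsDedekindDomain R] (𝔭 : Ideal R)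
    [𝔭.IsPrime] (h𝔭 : 𝔭 ≠ ⊥) {π : R} (hπ : π ∈ 𝔭) (hπ' : π ∉ 𝔭 ^ 2) {Q : ℕ}
    (hQ : ∀ x : R, x ^ Q - x ∈ 𝔭) {n : ℕ} {x : R} (hx : x ∈ 𝔭 ^ n) (L : ℕ) :
    ∃ y : ℕ → R, x - ∑ j ∈ Finset.range L, π ^ (n + j) * y j ^ Q ∈ 𝔭 ^ (n + L) := by
  have hpow (i : ℕ) : π ^ i ∉ 𝔭 ^ (i + 1) := by
    have hprime : Prime 𝔭 := Ideal.prime_of_isPrime h𝔭 inferInstance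
    have hone : emultiplicity 𝔭 (Ideal.span {π}) = (1 : ℕ) := by
      rw [emultiplicity_eq_coe, pow_one, Ideal.dvd_span_singleton, Ideal.dvd_span_singleton]
      exact ⟨hπ, hπ'⟩
    rw [← Ideal.dvd_span_singleton, ← Ideal.span_singleton_pow, pow_dvd_iff_le_emultiplicity,
      emultiplicity_pow hprime, hone]
    norm_cast
    omega
  induction L with
  | zero => exact ⟨0, by simpa using hx⟩
  | succ L ih =>
    obtain ⟨y, hy⟩ := ih
    -- The next coefficient `z` matters only modulo `𝔭`, so `z ^ Q` can replace it.
    obtain ⟨z, e, he, hz⟩ := Ideal.exists_mul_add_mem_pow_succ h𝔭 _ _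
      (Ideal.pow_mem_pow hπ (n + L)) (hpow (n + L)) hy
    refine ⟨Function.update y L z, ?_⟩
    have hsum : ∑ j ∈ Finset.range L, π ^ (n + j) * Function.update y L z j ^ Q =
        ∑ j ∈ Finset.range L, π ^ (n + j) * y j ^ Q :=
      Finset.sum_congr rfl fun j hj => by
        rw [Function.update_of_ne (Finset.mem_range.mp hj).ne]
    rw [Finset.sum_range_succ, hsum, Function.update_self, ← sub_sub, ← hz]
    have : π ^ (n + L) * z + e - π ^ (n + L) * z ^ Q = e - π ^ (n + L) * (z ^ Q - z) := by ring
    rw [this]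
    refine sub_mem he ?_
    rw [← add_assoc, pow_succ]
    exact Ideal.mul_mem_mul (Ideal.pow_mem_pow hπ _) (hQ z)

theorem pow_card_pow_sub_self_mem {R : Type*} [CommRing R] (𝔭 : Ideal R) [𝔭.IsMaximal]
    [Finite (R ⧸ 𝔭)] (N : ℕ) (x : R) : x ^ Nat.card (R ⧸ 𝔭) ^ N - x ∈ 𝔭 := by
  let := Ideal.Quotient.field 𝔭
  have := Fintype.ofFinite (R ⧸ 𝔭)
  rw [← Ideal.Quotient.eq, map_pow, Nat.card_eq_fintype_card, FiniteField.pow_card_pow]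

end Expansion

open MulAction
open scoped Pointwise

/-! ### Inertia and decomposition groups in a tower -/

section Tower

variable {k K G : Type*} [Field k] [NumberField k] [Field K] [NumberField K] [Algebra k K]
  [Group G] [Finite G] [MulSemiringAction G K] [IsGaloisGroup G ℚ K]

omit [NumberField k] [NumberField K] in
theorem under_ne_bot_of_ne_bot {P : Ideal (𝓞 K)} [P.IsPrime] (hP : P ≠ ⊥) :
    P.under (𝓞 k) ≠ ⊥ :=
  mt Ideal.eq_bot_of_comap_eq_bot hP

variable (H : Subgroup G) [IsGaloisGroup H k K] (P : Ideal (𝓞 K)) [P.IsPrime]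

omit [Finite G] [IsGaloisGroup G ℚ K] in
theorem isGaloisGroup_ringOfIntegers : IsGaloisGroup H (𝓞 k) (𝓞 K) := by
  have : SMulDistribClass H (𝓞 K) K := ⟨fun h x y => smul_distrib_smul h.1 x y⟩
  exact IsGaloisGroup.of_isFractionRing H (𝓞 k) (𝓞 K) k K

omit [IsGaloisGroup G ℚ K] in
theorem card_inertia_eq_ramificationIdx :
    Nat.card (P.inertia H) = P.ramificationIdx (𝓞 k) := by
  have := isGaloisGroup_ringOfIntegers (k := k) (K := K) H
  rw [Ideal.card_inertia_eq_ramificationIdxIn (P.under (𝓞 k)) P,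
    Ideal.ramificationIdxIn_eq_ramificationIdx (P.under (𝓞 k)) P H]

omit [IsGaloisGroup G ℚ K] in
theorem map_under_le_pow_card_inertia (hP : P ≠ ⊥) :
    (P.under (𝓞 k)).map (algebraMap (𝓞 k) (𝓞 K)) ≤ P ^ Nat.card (P.inertia H) := by
  have := under_ne_bot_of_ne_bot (k := k) hP
  rw [card_inertia_eq_ramificationIdx (k := k) H P,
    ← Ideal.ramificationIdx'_eq_ramificationIdx (P.under (𝓞 k)) P this]
  exact Ideal.le_pow_ramificationIdx'

/-- For `G` over `ℤ` and for `H` over `𝓞 k`, the decomposition group has order inertia times residue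
degree; residue degrees multiply in the tower. -/
theorem card_stabilizer_mul_card_inertia :
    Nat.card (stabilizer G P) * Nat.card (P.inertia H) =
      Nat.card (stabilizer H P) *
        (Nat.card (P.inertia G) * (P.under (𝓞 k)).inertiaDeg ℤ) := by
  have := isGaloisGroup_ringOfIntegers (k := k) (K := K) H
  have hH : Nat.card (stabilizer H P) = Nat.card (P.inertia H) * P.inertiaDeg (𝓞 k) :=
    Ideal.card_stabilizer_eq_card_inertia_mul_finrank (P.under (𝓞 k)) P
  rw [hH, Ideal.card_stabilizer_eq_card_inertia_mul_finrank (P.under ℤ) P (G := G),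
    Ideal.inertiaDeg_tower (R := ℤ) (P.under (𝓞 k)) P]
  ring

end Tower

/-! ### Orbits of a subgroup -/

section Orbits

variable {G α : Type*} [Group G] [MulAction G α]

/-- Orbit-stabilizer for `J`, with the stabilizer seen inside `stabilizer G a`: for `J` an inertia
or decomposition group, this is the corresponding group of the smaller Galois group. -/
theorem card_orbit_mul_card_subgroupOf (J : Subgroup G) (a : α) :
    Nat.card (orbit J a) * Nat.card (J.subgroupOf (stabilizer G a)) = Nat.card J := by
  rw [← Nat.card_congr (orbitProdStabilizerEquivGroup J a), Nat.card_prod]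
  congr 1
  refine Nat.card_congr ⟨fun h => ⟨⟨h.1.1, h.2⟩, h.1.2⟩, fun h => ⟨⟨h.1.1, h.2⟩, h.1.2⟩, ?_, ?_⟩ <;>
    exact fun _ => rfl

end Orbits

/-! ### Embeddings of `k` and a prime of the Galois hull -/

section Hull

variable (k : Type*) [Field k] [NumberField k]

theorem numberField_galoisHull : NumberField (galoisHull k) where
  to_finiteDimensional := by
    have h : FiniteDimensional ℚ (galoisHull k) := inferInstance
    convert h

attribute [local instance] numberField_galoisHull

variable {k}

/-- The embedding `σ`, regarded as a map of rings of integers. -/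
noncomputable def intEmb (σ : Emb k) : 𝓞 k →+* 𝓞 (galoisHull k) :=
  NumberField.RingOfIntegers.mapRingHom (toHull σ : k →+* galoisHull k)

theorem intEmb_smul (g : galoisGroup k) (σ : Emb k) (x : 𝓞 k) :
    intEmb (g • σ) x = g • intEmb σ x :=
  rfl

theorem exists_smul_eq (σ τ : Emb k) : ∃ g : galoisGroup k, g • σ = τ := by
  -- The hull is a `k`-algebra through `σ` and through `τ`; by normality the identity of `k` lifts
  -- to an automorphism between the two structures.
  let A₁ : Algebra k (galoisHull k) := (toHull σ : k →+* galoisHull k).toAlgebra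
  let A₂ : Algebra k (galoisHull k) := (toHull τ : k →+* galoisHull k).toAlgebra
  have T₁ : @IsScalarTower ℚ k (galoisHull k) _ A₁.toSMul _ :=
    @IsScalarTower.of_algebraMap_eq' ℚ k (galoisHull k) _ _ _ _ A₁ _ (Subsingleton.elim _ _)
  have T₂ : @IsScalarTower ℚ k (galoisHull k) _ A₂.toSMul _ :=
    @IsScalarTower.of_algebraMap_eq' ℚ k (galoisHull k) _ _ _ _ A₂ _ (Subsingleton.elim _ _)
  refine ⟨@AlgEquiv.liftNormal ℚ _ k k _ _ _ _ AlgEquiv.refl (galoisHull k) _ _ A₁ A₂ T₁ T₂ _,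
    AlgHom.ext fun x => ?_⟩
  exact congrArg (Subtype.val : galoisHull k → AlgebraicClosure ℚ) <|
    @AlgEquiv.liftNormal_commutes ℚ _ k k _ _ _ _ AlgEquiv.refl (galoisHull k) _ _
    A₁ A₂ T₁ T₂ _ x

theorem card_emb : Fintype.card (Emb k) = Module.finrank ℚ k :=
  AlgHom.card ℚ k _

theorem stabilizer_eq_fixingSubgroup (σ : Emb k) :
    stabilizer (galoisGroup k) σ =
      fixingSubgroup (galoisGroup k) (Set.range (toHull σ)) := by
  ext g
  rw [mem_stabilizer_iff, mem_fixingSubgroup_iff]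
  constructor
  · rintro h _ ⟨x, rfl⟩
    exact Subtype.ext (DFunLike.congr_fun h x)
  · exact fun h => AlgHom.ext fun x => congrArg Subtype.val (h _ ⟨x, rfl⟩)

/-- The ramification index over `σ(k)` of a prime of the hull. -/
noncomputable def relRamification (P : Ideal (𝓞 (galoisHull k))) (σ : Emb k) : ℕ :=
  Nat.card (P.inertia (stabilizer (galoisGroup k) σ))

variable (P : Ideal (𝓞 (galoisHull k))) [P.IsPrime]

/-- Lets the results on towers apply along any `σ`; the algebra structure is existential because it
varies with `σ`. -/
theorem exists_isGaloisGroup (σ : Emb k) :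
    ∃ _ : Algebra k (galoisHull k), algebraMap (𝓞 k) (𝓞 (galoisHull k)) = intEmb σ ∧
      IsGaloisGroup (stabilizer (galoisGroup k) σ) k (galoisHull k) := by
  let _ : Algebra k (galoisHull k) := (toHull σ : k →+* galoisHull k).toAlgebra
  refine ⟨inferInstance, rfl, ?_⟩
  have : IsScalarTower ℚ k (galoisHull k) := .of_algebraMap_eq' (Subsingleton.elim _ _)
  have h := IsGaloisGroup.of_isScalarTower (galoisGroup k) ℚ (galoisHull k) k
  rw [stabilizer_eq_fixingSubgroup]
  exact h

theorem map_comap_intEmb_le (hP : P ≠ ⊥) (σ : Emb k) :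
    (P.comap (intEmb σ)).map (intEmb σ) ≤ P ^ relRamification P σ := by
  obtain ⟨_, h, _⟩ := exists_isGaloisGroup σ
  have := map_under_le_pow_card_inertia (k := k) (stabilizer (galoisGroup k) σ) P hP
  rw [Ideal.under_def, h] at this
  exact this

theorem card_stabilizer_mul_relRamification (σ : Emb k) :
    Nat.card (stabilizer (galoisGroup k) P) * relRamification P σ =
      Nat.card (stabilizer (stabilizer (galoisGroup k) σ) P) *
        (Nat.card (P.inertia (galoisGroup k)) * (P.comap (intEmb σ)).inertiaDeg ℤ) := by
  obtain ⟨_, h, _⟩ := exists_isGaloisGroup σ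
  have := card_stabilizer_mul_card_inertia (k := k) (stabilizer (galoisGroup k) σ) P
  rw [Ideal.under_def, h] at this
  exact this

omit [P.IsPrime] in
theorem card_orbit_mul_relRamification (σ : Emb k) :
    Nat.card (orbit (P.inertia (galoisGroup k)) σ) * relRamification P σ =
      Nat.card (P.inertia (galoisGroup k)) :=
  card_orbit_mul_card_subgroupOf (P.inertia (galoisGroup k)) σ

/-- The embeddings that pull `P` back to the same prime of `k` form an orbit of the decomposition
group. -/
theorem setOf_comap_eq_orbit (σ : Emb k) :
    {τ : Emb k | P.comap (intEmb τ) = P.comap (intEmb σ)} =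
      orbit (stabilizer (galoisGroup k) P) σ := by
  ext τ
  constructor
  · intro hτ
    obtain ⟨g, rfl⟩ := exists_smul_eq σ τ
    obtain ⟨_, hmap, _⟩ := exists_isGaloisGroup σ
    have := isGaloisGroup_ringOfIntegers (k := k) (K := galoisHull k)
      (stabilizer (galoisGroup k) σ)
    -- Along `σ`, both `g⁻¹ • P` and `P` lie over the same prime, so an element `h` fixing `σ`
    -- carries one to the other. Then `g * h⁻¹` stabilizes `P` and still sends `σ` to `g • σ`.
    have hcomap : (g⁻¹ • P).under (𝓞 k) = P.under (𝓞 k) := by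
      rw [Ideal.under_def, Ideal.under_def, hmap]
      refine Eq.trans (Ideal.ext fun x => ?_) hτ
      rw [Ideal.mem_comap, Ideal.mem_comap, Ideal.mem_inv_pointwise_smul_iff, intEmb_smul]
    obtain ⟨h, hh⟩ := Algebra.IsInvariant.exists_smul_of_under_eq (𝓞 k) (𝓞 (galoisHull k))
      (stabilizer (galoisGroup k) σ) (g⁻¹ • P) P hcomap
    have hg : g * (h : galoisGroup k)⁻¹ ∈ stabilizer (galoisGroup k) P := by
      rw [mem_stabilizer_iff, mul_smul, smul_eq_iff_eq_inv_smul, inv_smul_eq_iff]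
      exact hh
    refine ⟨⟨_, hg⟩, ?_⟩
    change (g * (h : galoisGroup k)⁻¹) • σ = g • σ
    rw [mul_smul, inv_smul_eq_iff.mpr (mem_stabilizer_iff.mp h.2).symm]
  · rintro ⟨g, rfl⟩
    ext x
    have h : g.1 • intEmb σ x ∈ g.1 • P ↔ intEmb σ x ∈ P := Ideal.smul_mem_pointwise_smul_iff
    rwa [mem_stabilizer_iff.mp g.2] at h

/-- By `setOf_comap_eq_orbit` the fibre is an orbit of the decomposition group. Orbit-stabilizer
gives its size, and the order of the decomposition group over `σ(k)` cancels. -/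
theorem card_comap_eq_mul_relRamification (σ : Emb k) :
    Nat.card {τ : Emb k // P.comap (intEmb τ) = P.comap (intEmb σ)} * relRamification P σ =
      Nat.card (P.inertia (galoisGroup k)) * (P.comap (intEmb σ)).inertiaDeg ℤ := by
  have h1 := card_orbit_mul_card_subgroupOf (stabilizer (galoisGroup k) P) σ
  have h2 := card_stabilizer_mul_relRamification P σ
  rw [← setOf_comap_eq_orbit P σ] at h1
  have h3 : (stabilizer (galoisGroup k) P).subgroupOf (stabilizer (galoisGroup k) σ) =
      stabilizer (stabilizer (galoisGroup k) σ) P := rfl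
  rw [← h1, h3] at h2
  have hpos : 0 < Nat.card (stabilizer (stabilizer (galoisGroup k) σ) P) := Nat.card_pos
  refine Nat.eq_of_mul_eq_mul_left hpos ?_
  rw [← h2]
  exact mul_assoc _ _ _ |>.symm.trans (congrArg (· * _) (mul_comm _ _))

end Hull

attribute [local instance] numberField_galoisHull

/-! ### The local bound at `P` -/

section LocalBound

variable {k : Type*} [Field k] [NumberField k] (P : Ideal (𝓞 (galoisHull k)))

/-- The order of vanishing of `𝔫` at the prime below `P` along `σ`. -/
noncomputable def idealOrd (𝔫 : Ideal (𝓞 k)) (σ : Emb k) : ℕ :=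
  multiplicity (P.comap (intEmb σ)) 𝔫

/-- The class of an embedding modulo the inertia group. -/
noncomputable def inertiaClass (σ : Emb k) : orbitRel.Quotient (P.inertia (galoisGroup k)) (Emb k) :=
  Quotient.mk'' σ

variable {P}

theorem inertiaClass_eq_iff {σ τ : Emb k} :
    inertiaClass P σ = inertiaClass P τ ↔ σ ∈ orbit (P.inertia (galoisGroup k)) τ := by
  unfold inertiaClass
  rw [Quotient.eq'', orbitRel_apply]

theorem intEmb_sub_intEmb_mem {σ τ : Emb k} (h : inertiaClass P σ = inertiaClass P τ)
    (x : 𝓞 k) : intEmb σ x - intEmb τ x ∈ P := by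
  obtain ⟨g, rfl⟩ := inertiaClass_eq_iff.mp h
  exact g.2 (intEmb τ x)

theorem comap_intEmb_eq {σ τ : Emb k} (h : inertiaClass P σ = inertiaClass P τ) :
    P.comap (intEmb σ) = P.comap (intEmb τ) := by
  ext x
  have := intEmb_sub_intEmb_mem h x
  rw [Ideal.mem_comap, Ideal.mem_comap]
  exact ⟨fun hx => by simpa using sub_mem hx this, fun hx => by simpa using add_mem this hx⟩

theorem relRamification_eq {σ τ : Emb k} (h : inertiaClass P σ = inertiaClass P τ) :
    relRamification P σ = relRamification P τ := by
  have h1 := card_orbit_mul_relRamification P σ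
  rw [orbit_eq_iff.mpr (inertiaClass_eq_iff.mp h), ← card_orbit_mul_relRamification P τ] at h1
  have : Nonempty (orbit (P.inertia (galoisGroup k)) τ) := ⟨⟨τ, mem_orbit_self τ⟩⟩
  exact Nat.eq_of_mul_eq_mul_left Nat.card_pos h1

theorem comap_intEmb_ne_bot [P.IsPrime] (hP : P ≠ ⊥) (σ : Emb k) : P.comap (intEmb σ) ≠ ⊥ := by
  obtain ⟨_, h, _⟩ := exists_isGaloisGroup σ
  have := under_ne_bot_of_ne_bot (k := k) hP
  rwa [Ideal.under_def, h] at this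

theorem idealOrd_eq (𝔫 : Ideal (𝓞 k)) {σ τ : Emb k}
    (h : inertiaClass P σ = inertiaClass P τ) : idealOrd P 𝔫 σ = idealOrd P 𝔫 τ := by
  rw [idealOrd, comap_intEmb_eq h, idealOrd]

/-- This ignores ramification, which suffices for the error term of an expansion. -/
theorem intEmb_mem_pow (σ : Emb k) {i : ℕ} {x : 𝓞 k} (hx : x ∈ P.comap (intEmb σ) ^ i) :
    intEmb σ x ∈ P ^ i := by
  have h := Ideal.mem_map_of_mem (intEmb σ) hx
  rw [Ideal.map_pow] at h
  exact Ideal.pow_right_mono Ideal.map_comap_le i h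

variable (P)

/-- The weight of a pair of embeddings in one class modulo the inertia group. -/
noncomputable def embWeight (σ τ : Emb k) : ℕ :=
  pairWeight (inertiaClass P) (relRamification P) σ τ

/-- The squared determinant of embeddings of elements of `𝔫` is highly divisible by `P`. -/
theorem det_sq_intEmb_mem [P.IsPrime] (hP : P ≠ ⊥) (𝔫 : Ideal (𝓞 k)) {m : ℕ}
    {s : Fin m → Emb k} (hs : Function.Injective s) {x : Fin m → 𝓞 k} (hx : ∀ j, x j ∈ 𝔫) :
    (Matrix.of fun i j => intEmb (s i) (x j)).det ^ 2 ∈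
      P ^ ((∑ i, 2 * (relRamification P (s i) * idealOrd P 𝔫 (s i))) +
        ∑ i, ∑ j, embWeight P (s i) (s j)) := by
  set B := (∑ i, 2 * (relRamification P (s i) * idealOrd P 𝔫 (s i))) +
    ∑ i, ∑ j, embWeight P (s i) (s j) with hB
  -- One uniformizer and one family of coefficients serve a whole inertia orbit; the coefficients
  -- are images under a fixed representative.
  have hexp (c : orbitRel.Quotient (P.inertia (galoisGroup k)) (Emb k)) :
      ∃ (π : 𝓞 k) (A : ℕ → Fin m → 𝓞 (galoisHull k)), ∀ τ, inertiaClass P τ = c →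
        π ∈ P.comap (intEmb τ) ∧ ∀ j, intEmb τ (x j) - ∑ l ∈ Finset.range B,
          intEmb τ π ^ (idealOrd P 𝔫 τ + l) * A l j ∈ P ^ B := by
    obtain ⟨σ, rfl⟩ := Quotient.exists_rep c
    change ∃ _ _, ∀ τ, inertiaClass P τ = inertiaClass P σ → _
    set 𝔭 := P.comap (intEmb σ) with h𝔭
    have h𝔭0 : 𝔭 ≠ ⊥ := comap_intEmb_ne_bot hP σ
    have : 𝔭.IsPrime := Ideal.comap_isPrime _ _
    have : 𝔭.IsMaximal := Ideal.IsPrime.isMaximal this h𝔭0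
    have : Finite (𝓞 k ⧸ 𝔭) := Ideal.finiteQuotientOfFreeOfNeBot 𝔭 h𝔭0
    obtain ⟨π, hπ, hπ'⟩ := Ideal.exists_mem_pow_notMem_pow_succ 𝔭 h𝔭0
      (Ideal.IsPrime.ne_top inferInstance) 1
    rw [pow_one] at hπ
    have hmem (j : Fin m) : x j ∈ 𝔭 ^ idealOrd P 𝔫 σ :=
      Ideal.le_of_dvd (pow_multiplicity_dvd _ _) (hx j)
    choose y hy using fun j => exists_expansion 𝔭 h𝔭0 hπ hπ'
      (pow_card_pow_sub_self_mem 𝔭 B) (hmem j) B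
    refine ⟨π, fun l j => intEmb σ (y j l ^ Nat.card (𝓞 k ⧸ 𝔭) ^ B), fun τ hτ => ?_⟩
    have hcomap := comap_intEmb_eq hτ
    refine ⟨hcomap ▸ hπ, fun j => ?_⟩
    have hcard : ((Nat.card (𝓞 k ⧸ 𝔭) : ℕ) : 𝓞 (galoisHull k)) ∈ P := by
      rw [← map_natCast (intEmb σ)]
      exact Ideal.absNorm_mem 𝔭
    have h1 : intEmb τ (x j - ∑ l ∈ Finset.range B,
        π ^ (idealOrd P 𝔫 σ + l) * y j l ^ Nat.card (𝓞 k ⧸ 𝔭) ^ B) ∈ P ^ B := by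
      refine Ideal.pow_le_pow_right (Nat.le_add_left B (idealOrd P 𝔫 σ)) (intEmb_mem_pow τ ?_)
      rw [hcomap]
      exact hy j
    -- Replacing `τ` by the representative `σ` in the coefficients costs only `P ^ (B + 1)`, since
    -- they are `q ^ B`-th powers.
    have h2 : ∑ l ∈ Finset.range B, intEmb τ π ^ (idealOrd P 𝔫 σ + l) *
        (intEmb τ (y j l) ^ Nat.card (𝓞 k ⧸ 𝔭) ^ B -
          intEmb σ (y j l) ^ Nat.card (𝓞 k ⧸ 𝔭) ^ B) ∈ P ^ B :=
      Ideal.sum_mem _ fun l _ => Ideal.mul_mem_left _ _ <| Ideal.pow_le_pow_right B.le_succ <|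
        pow_pow_sub_pow_pow_mem P hcard (intEmb_sub_intEmb_mem hτ _) B
    rw [idealOrd_eq 𝔫 hτ]
    convert add_mem h1 h2 using 1
    simp only [map_sub, map_sum, map_mul, map_pow, mul_sub, Finset.sum_sub_distrib]
    ring
  choose π A hπA using hexp
  refine det_sq_mem_pow P (cl := fun i => inertiaClass P (s i))
    (ε := fun i => relRamification P (s i)) (n := fun i => idealOrd P 𝔫 (s i))
    (fun i j h => relRamification_eq h) B B ?_ (fun i => intEmb (s i) (π (inertiaClass P (s i))))
    (fun i => ?_) A _ fun i j => (hπA _ (s i) rfl).2 j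
  · rw [hB]
    congr 1
    refine Finset.sum_congr rfl fun i _ => Finset.sum_congr rfl fun j _ => ?_
    exact pairWeight_comp hs _ _ i j
  · exact map_comap_intEmb_le P hP (s i) (Ideal.mem_map_of_mem _ (hπA _ (s i) rfl).1)

end LocalBound

/-! ### Totals over all embeddings -/

section Sums

variable {k : Type*} [Field k] [NumberField k] (P : Ideal (𝓞 (galoisHull k)))

/-- If the inertia orbit of `σ` has `s` elements, its weights sum to `(s - 1) * e_σ`, while `s * e_σ
= |I|`. -/
theorem sum_embWeight_add (σ : Emb k) :
    (∑ τ, embWeight P σ τ) + relRamification P σ = Nat.card (P.inertia (galoisGroup k)) := by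
  rw [← card_orbit_mul_relRamification P σ,
    Nat.card_congr (Equiv.subtypeEquivRight fun τ => (inertiaClass_eq_iff (P := P)).symm)]
  exact sum_pairWeight_add _ _ σ

theorem embWeight_self (σ : Emb k) : embWeight P σ σ = 0 :=
  pairWeight_self _ _ _

theorem embWeight_comm (σ τ : Emb k) : embWeight P σ τ = embWeight P τ σ :=
  pairWeight_comm (fun _ _ => relRamification_eq) σ τ

variable [P.IsPrime]

theorem exists_comap_intEmb_eq (𝔭 : Ideal (𝓞 k)) [𝔭.IsPrime]
    (h𝔭 : 𝔭.under ℤ = P.under ℤ) : ∃ σ : Emb k, P.comap (intEmb σ) = 𝔭 := by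
  obtain ⟨σ⟩ : Nonempty (Emb k) := by
    rw [← Fintype.card_pos_iff, card_emb]
    exact Module.finrank_pos
  obtain ⟨_, hmap, _⟩ := exists_isGaloisGroup σ
  obtain ⟨⟨Q, _, hQ⟩⟩ := (inferInstance : Nonempty (𝔭.primesOver (𝓞 (galoisHull k))))
  have hQZ : Q.under ℤ = P.under ℤ := by
    rw [← h𝔭, hQ.over, Ideal.under_under]
  obtain ⟨g, rfl⟩ := Algebra.IsInvariant.exists_smul_of_under_eq ℤ (𝓞 (galoisHull k))
    (galoisGroup k) P Q hQZ.symm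
  refine ⟨g⁻¹ • σ, ?_⟩
  rw [hQ.over, Ideal.under_def, hmap]
  ext x
  rw [Ideal.mem_comap, Ideal.mem_comap, intEmb_smul, Ideal.mem_pointwise_smul_iff_inv_smul_mem]

/-- The embeddings over one `𝔭` share their `e_σ`, and by `card_comap_eq_mul_relRamification` these
add up to `|I|` times the inertia degree. Used with `F` constant 1 and with `F` the multiplicity in
`𝔫`. -/
theorem sum_relRamification_mul (T : Finset (Ideal (𝓞 k)))
    (hT : ∀ 𝔭, 𝔭 ∈ T ↔ 𝔭.IsPrime ∧ 𝔭.under ℤ = P.under ℤ) (F : Ideal (𝓞 k) → ℕ) :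
    ∑ σ : Emb k, relRamification P σ * F (P.comap (intEmb σ)) =
      Nat.card (P.inertia (galoisGroup k)) * ∑ 𝔭 ∈ T, 𝔭.inertiaDeg ℤ * F 𝔭 := by
  classical
  have hmaps (σ : Emb k) (_ : σ ∈ Finset.univ) : P.comap (intEmb σ) ∈ T := by
    rw [hT]
    refine ⟨Ideal.comap_isPrime _ _, ?_⟩
    rw [Ideal.under_def, Ideal.under_def, Ideal.comap_comap]
    congr 1
    exact Subsingleton.elim _ _
  rw [← Finset.sum_fiberwise_of_maps_to hmaps, Finset.mul_sum]
  refine Finset.sum_congr rfl fun 𝔭 h𝔭 => ?_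
  have := ((hT 𝔭).mp h𝔭).1
  obtain ⟨σ, rfl⟩ := exists_comap_intEmb_eq P 𝔭 ((hT 𝔭).mp h𝔭).2
  have hcard := card_comap_eq_mul_relRamification P σ
  have hconst (τ : Emb k) (hτ : P.comap (intEmb τ) = P.comap (intEmb σ)) :
      relRamification P τ = relRamification P σ := by
    have h1 := card_comap_eq_mul_relRamification P τ
    rw [hτ, ← hcard] at h1
    have : Nonempty {τ : Emb k // P.comap (intEmb τ) = P.comap (intEmb σ)} := ⟨⟨σ, rfl⟩⟩
    exact Nat.eq_of_mul_eq_mul_left Nat.card_pos h1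
  have hsum : ∀ τ ∈ Finset.univ.filter fun τ => P.comap (intEmb τ) = P.comap (intEmb σ),
      relRamification P τ * F (P.comap (intEmb τ)) =
        relRamification P σ * F (P.comap (intEmb σ)) := fun τ hτ => by
    rw [(Finset.mem_filter.mp hτ).2, hconst τ (Finset.mem_filter.mp hτ).2]
  rw [Finset.sum_congr rfl hsum, Finset.sum_const, smul_eq_mul, ← mul_assoc, ← mul_assoc,
    ← hcard, Nat.card_eq_fintype_card, Fintype.card_subtype]

end Sums

/-! ### From powers of `P` to powers of `p` -/

section Valuation

variable {K : Type*} [Field K] [NumberField K] {G : Type*} [Group G] [Finite G]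
  [MulSemiringAction G K] [IsGaloisGroup G ℚ K]

/-- An integer that is highly divisible by a prime above `p` is highly divisible by `p`. -/
theorem pow_dvd_of_mem_pow (P : Ideal (𝓞 K)) [P.IsPrime] {p : ℕ} (hp : p.Prime)
    [P.LiesOver (Ideal.span {(p : ℤ)})] (N : ℤ) {t u : ℕ} (hN : (N : 𝓞 K) ∈ P ^ t)
    (ht : Nat.card (P.inertia G) * u ≤ t) : (p : ℤ) ^ u ∣ N := by
  by_cases hN0 : N = 0
  · simp [hN0]
  have hpZ : Prime (p : ℤ) := Nat.prime_iff_prime_int.mp hp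
  have hspan0 : Ideal.span {(p : ℤ)} ≠ ⊥ := by simpa using hp.ne_zero
  have : (Ideal.span {(p : ℤ)}).IsPrime := (Ideal.span_singleton_prime hpZ.ne_zero).mpr hpZ
  have hmap0 : (Ideal.span {(p : ℤ)}).map (algebraMap ℤ (𝓞 K)) ≠ ⊥ :=
    Ideal.map_ne_bot_of_ne_bot hspan0
  have hP0 : P ≠ ⊥ := Ideal.ne_bot_of_liesOver_of_ne_bot hspan0 P
  have hPprime : Prime P := Ideal.prime_of_isPrime hP0 inferInstance
  have hE : Nat.card (P.inertia G) =
      multiplicity P ((Ideal.span {(p : ℤ)}).map (algebraMap ℤ (𝓞 K))) := by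
    rw [Ideal.card_inertia_eq_ramificationIdxIn (Ideal.span {(p : ℤ)}) P,
      Ideal.ramificationIdxIn_eq_ramificationIdx (Ideal.span {(p : ℤ)}) P G,
      Ideal.IsDedekindDomain.ramificationIdx_eq_multiplicity (Ideal.span {(p : ℤ)}) P hmap0]
  have hEpos : 0 < Nat.card (P.inertia G) := Nat.card_pos
  have hfinN : FiniteMultiplicity (p : ℤ) N := .of_prime_left hpZ hN0
  obtain ⟨v, hNv, hv⟩ := hfinN.exists_eq_pow_mul_and_not_dvd
  generalize multiplicity (p : ℤ) N = r at hNv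
  subst hNv
  refine Dvd.dvd.mul_right (pow_dvd_pow _ ?_) _
  rw [Ideal.map_span, Set.image_singleton] at hE hmap0
  -- Since `P` meets `ℤ` in `(p)`, the part of `N` prime to `p` is a unit at `P`.
  have hvP : ¬ P ∣ Ideal.span {(v : 𝓞 K)} := by
    rw [Ideal.dvd_span_singleton]
    intro h
    apply hv
    rw [← Ideal.mem_span_singleton, Ideal.over_def P (Ideal.span {(p : ℤ)}), Ideal.mem_comap]
    simpa using h
  have hfin : FiniteMultiplicity P (Ideal.span {algebraMap ℤ (𝓞 K) p}) :=
    FiniteMultiplicity.of_prime_left hPprime hmap0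
  rw [← Ideal.dvd_span_singleton] at hN
  have hle := le_emultiplicity_of_pow_dvd hN
  have hsplit : Ideal.span {(((p : ℤ) ^ r * v : ℤ) : 𝓞 K)} =
      Ideal.span {algebraMap ℤ (𝓞 K) p} ^ r * Ideal.span {(v : 𝓞 K)} := by
    simp [Ideal.span_singleton_pow, Ideal.span_singleton_mul_span_singleton]
  rw [hsplit, emultiplicity_mul hPprime, emultiplicity_pow hPprime,
    emultiplicity_eq_zero.mpr hvP, hfin.emultiplicity_eq_multiplicity, ← hE, add_zero] at hle
  have hle' : t ≤ r * Nat.card (P.inertia G) := by exact_mod_cast hle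
  refine Nat.le_of_mul_le_mul_left ?_ hEpos
  rw [mul_comm _ r]
  exact ht.trans hle'

end Valuation

/-! ### Prime exponents of the norm and of the tame discriminant -/

section Factorization

variable {k : Type*} [Field k] [NumberField k]

theorem factorization_absNorm_le {𝔫 : Ideal (𝓞 k)} (h𝔫 : 𝔫 ≠ ⊥) (p : ℕ)
    (T : Finset (Ideal (𝓞 k)))
    (hT : ∀ 𝔭, 𝔭 ∈ T ↔ 𝔭.IsPrime ∧ 𝔭.under ℤ = Ideal.span {(p : ℤ)}) :
    (Ideal.absNorm 𝔫).factorization p ≤ ∑ 𝔭 ∈ T, 𝔭.inertiaDeg ℤ * multiplicity 𝔭 𝔫 := by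
  classical
  open UniqueFactorizationMonoid in
  have hprime (q : Ideal (𝓞 k)) (hq : q ∈ (normalizedFactors 𝔫).toFinset) : Prime q :=
    prime_of_normalized_factor q (Multiset.mem_toFinset.mp hq)
  have hpos (q : Ideal (𝓞 k)) (hq : q ∈ (normalizedFactors 𝔫).toFinset) :
      Ideal.absNorm q ^ (normalizedFactors 𝔫).count q ≠ 0 :=
    pow_ne_zero _ (Ideal.absNorm_eq_zero_iff.not.mpr (hprime q hq).ne_zero)
  conv_lhs => rw [← Ideal.prod_normalizedFactors_eq_self h𝔫, Finset.prod_multiset_count, map_prod]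
  simp only [map_pow]
  rw [Nat.factorization_prod hpos, Finset.sum_apply']
  refine (Finset.sum_le_sum fun q hq => ?_).trans (Finset.sum_le_sum_of_ne_zero
    (f := fun 𝔭 => if 𝔭 ∈ T then 𝔭.inertiaDeg ℤ * multiplicity 𝔭 𝔫 else 0) fun q _ hq => ?_)|>.trans
      (Finset.sum_congr rfl fun q hq => if_pos hq).le
  · have hqp := hprime q hq
    have : q.IsPrime := Ideal.isPrime_of_prime hqp
    have : NeZero q := ⟨hqp.ne_zero⟩
    have hl := Nat.absNorm_under_prime q
    set l := Ideal.absNorm (q.under ℤ) with hldef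
    rw [Nat.factorization_pow, Finsupp.smul_apply, ← Ideal.pow_inertiaDeg l q,
      Nat.factorization_pow, Finsupp.smul_apply, hl.factorization, Finsupp.single_apply]
    by_cases hlp : l = p
    · have hqT : q ∈ T := (hT q).mpr ⟨inferInstance, by
        rw [← hlp, hldef, Int.ideal_span_absNorm_eq_self]⟩
      rw [if_pos hlp, if_pos hqT, multiplicity_eq_count_normalizedFactors hqp.irreducible h𝔫,
        normalize_eq]
      simp [mul_comm]
    · simp [hlp]
  · by_contra h
    simp [h] at hq

theorem factorization_tameDiscr (p : Nat.Primes) :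
    (tameDiscr k).factorization p = Module.finrank ℚ k - inertiaSum k p := by
  classical
  have hsub : (Function.mulSupport fun p : Nat.Primes =>
      (p : ℕ) ^ (Module.finrank ℚ k - inertiaSum k p)) ⊆ (finite_tame k).toFinset := by
    intro q hq
    rw [Set.Finite.coe_toFinset]
    intro h
    simp [h] at hq
  rw [tameDiscr, finprod_eq_prod_of_mulSupport_subset _ hsub,
    Nat.factorization_prod fun q _ => pow_ne_zero _ q.2.ne_zero, Finset.sum_apply']
  have hterm (q : Nat.Primes) :
      ((q : ℕ) ^ (Module.finrank ℚ k - inertiaSum k q)).factorization p =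
        if q = p then Module.finrank ℚ k - inertiaSum k p else 0 := by
    rw [Nat.factorization_pow, Finsupp.smul_apply, q.2.factorization, Finsupp.single_apply]
    by_cases h : q = p
    · simp [h]
    · simp [h, Nat.Primes.coe_nat_inj]
  simp only [hterm, Finset.sum_ite_eq']
  split_ifs with h
  · rfl
  · have : inertiaSum k p = Module.finrank ℚ k := by simpa using h
    simp [this]

theorem tameDiscr_ne_zero : tameDiscr k ≠ 0 := by
  rw [tameDiscr, finprod_eq_prod_of_mulSupport_subset (s := (finite_tame k).toFinset)]
  · exact Finset.prod_ne_zero_iff.mpr fun q _ => pow_ne_zero _ q.2.ne_zero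
  · intro q hq
    rw [Set.Finite.coe_toFinset]
    intro h
    simp [h] at hq

end Factorization

/-! ### Averaged exponents -/

section Exponent

variable {k : Type*} [Field k] [NumberField k]

/-- The primes of `k` above `p`. -/
noncomputable def primesAbove (k : Type*) [Field k] [NumberField k] (p : ℕ) :
    Finset (Ideal (𝓞 k)) :=
  (Algebra.QuasiFinite.finite_primesOver (S := 𝓞 k) (Ideal.span {(p : ℤ)})).toFinset

theorem mem_primesAbove {p : ℕ} {𝔭 : Ideal (𝓞 k)} :
    𝔭 ∈ primesAbove k p ↔ 𝔭.IsPrime ∧ 𝔭.under ℤ = Ideal.span {(p : ℤ)} := by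
  rw [primesAbove, Set.Finite.mem_toFinset]
  exact ⟨fun h => ⟨h.1, h.2.over.symm⟩, fun h => ⟨h.1, ⟨h.2.symm⟩⟩⟩

variable (P : Ideal (𝓞 (galoisHull k))) (𝔫 : Ideal (𝓞 k))

/-- The exponent of `P` that divides the squared determinant of the translate `gS`. -/
noncomputable def translateExponent (S : Finset (Emb k)) (g : galoisGroup k) : ℕ :=
  (∑ σ ∈ S, 2 * (relRamification P (g • σ) * idealOrd P 𝔫 (g • σ))) +
    ∑ σ ∈ S, ∑ τ ∈ S, embWeight P (g • σ) (g • τ)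

/-- The exponent of `p` in the norm of `𝔫`. -/
noncomputable def normExponent (p : ℕ) : ℕ :=
  ∑ 𝔭 ∈ primesAbove k p, 𝔭.inertiaDeg ℤ * multiplicity 𝔭 𝔫

variable [P.IsPrime] (p : Nat.Primes) [P.LiesOver (Ideal.span {((p : ℕ) : ℤ)})]

theorem sum_relRamification_mul_idealOrd :
    ∑ σ : Emb k, relRamification P σ * idealOrd P 𝔫 σ =
      Nat.card (P.inertia (galoisGroup k)) * normExponent 𝔫 p :=
  sum_relRamification_mul P (primesAbove k p)
    (fun 𝔭 => by rw [mem_primesAbove, ← Ideal.over_def P (Ideal.span {((p : ℕ) : ℤ)})])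
    fun 𝔭 => multiplicity 𝔭 𝔫

theorem sum_sum_embWeight :
    ∑ σ : Emb k, ∑ τ, embWeight P σ τ =
      Nat.card (P.inertia (galoisGroup k)) * (Module.finrank ℚ k - inertiaSum k p) := by
  have h1 := sum_relRamification_mul P (primesAbove k p)
    (fun 𝔭 => by rw [mem_primesAbove, ← Ideal.over_def P (Ideal.span {((p : ℕ) : ℤ)})])
    fun _ => 1
  have h2 := Finset.sum_congr (rfl : (Finset.univ : Finset (Emb k)) = _)
    fun σ _ => sum_embWeight_add P σ
  simp only [mul_one] at h1
  rw [Finset.sum_add_distrib, h1, Finset.sum_const, Finset.card_univ, card_emb,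
    smul_eq_mul] at h2
  change _ + _ * inertiaSum k p = _ at h2
  rw [Nat.mul_sub, mul_comm _ (Module.finrank ℚ k)]
  omega

variable (S : Finset (Emb k))

theorem finrank_mul_sum_idealOrd :
    Module.finrank ℚ k * ∑ g : galoisGroup k,
        ∑ σ ∈ S, 2 * (relRamification P (g • σ) * idealOrd P 𝔫 (g • σ)) =
      Fintype.card (galoisGroup k) *
        (S.card * (2 * (Nat.card (P.inertia (galoisGroup k)) * normExponent 𝔫 p))) := by
  rw [← sum_relRamification_mul_idealOrd P 𝔫 p, Finset.mul_sum (s := Finset.univ (α := Emb k)),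
    ← card_emb]
  exact card_mul_sum_sum_smul exists_smul_eq
    (fun σ => 2 * (relRamification P σ * idealOrd P 𝔫 σ)) S

/-- Average `two_mul_sum_sum_le` over the translates of `S`. The truncated subtraction plays the
role of the maximum with 0. -/
theorem le_finrank_mul_sum_embWeight :
    Fintype.card (galoisGroup k) * ((2 * S.card - Module.finrank ℚ k) *
        (Nat.card (P.inertia (galoisGroup k)) * (Module.finrank ℚ k - inertiaSum k p))) ≤
      Module.finrank ℚ k * ∑ g : galoisGroup k,
        ∑ σ ∈ S, ∑ τ ∈ S, embWeight P (g • σ) (g • τ) := by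
  rw [← sum_sum_embWeight P p]
  have h1 := card_mul_sum_sum_smul (G := galoisGroup k) exists_smul_eq
    (fun σ : Emb k => ∑ τ, embWeight P σ τ) S
  have h2 (g : galoisGroup k) := two_mul_sum_sum_le (embWeight P) (embWeight_comm P)
    (translate g S)
  simp only [translate, Finset.sum_map, Equiv.coe_toEmbedding, MulAction.toPerm_apply] at h2
  have h3 := Finset.sum_le_sum fun g (_ : g ∈ (Finset.univ : Finset (galoisGroup k))) => h2 g
  rw [← Finset.mul_sum, Finset.sum_add_distrib, Finset.sum_const, Finset.card_univ,
    smul_eq_mul] at h3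
  rw [card_emb] at h1
  have h4 := Nat.mul_le_mul_left (Module.finrank ℚ k) h3
  rw [mul_left_comm, h1] at h4
  set W := ∑ σ : Emb k, ∑ τ, embWeight P σ τ
  rw [Nat.sub_mul, Nat.mul_sub, Nat.sub_le_iff_le_add]
  calc _ = 2 * (Fintype.card (galoisGroup k) * (S.card * W)) := by ring
    _ ≤ _ := h4
    _ = _ := by ring

theorem exists_smul_pair (h : IsTwoHomogeneous k) (σ τ σ' τ' : Emb k) (hστ : σ ≠ τ)
    (hστ' : σ' ≠ τ') :
    ∃ g : galoisGroup k, (g • σ = σ' ∧ g • τ = τ') ∨ (g • σ = τ' ∧ g • τ = σ') := by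
  classical
  obtain ⟨g, hg⟩ := h {σ, τ} {σ', τ'} (Finset.card_pair hστ) (Finset.card_pair hστ')
  refine ⟨g, ?_⟩
  have hpair : ({g • σ, g • τ} : Finset (Emb k)) = {σ', τ'} := by
    rw [← hg]
    simp [translate, Finset.map_insert]
  have hcoe : ({g • σ, g • τ} : Set (Emb k)) = {σ', τ'} := by
    simpa using congrArg (fun T : Finset (Emb k) => (T : Set (Emb k))) hpair
  exact Set.pair_eq_pair_iff.mp hcoe

theorem finrank_mul_sum_embWeight (h : IsTwoHomogeneous k) :
    Module.finrank ℚ k * (Module.finrank ℚ k - 1) * ∑ g : galoisGroup k,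
        ∑ σ ∈ S, ∑ τ ∈ S, embWeight P (g • σ) (g • τ) =
      Fintype.card (galoisGroup k) * (S.card * (S.card - 1) *
        (Nat.card (P.inertia (galoisGroup k)) * (Module.finrank ℚ k - inertiaSum k p))) := by
  rw [← sum_sum_embWeight P p, ← card_emb]
  exact card_mul_sum_sum_sum_smul (exists_smul_pair h) (embWeight P) (embWeight_self P)
    (embWeight_comm P) S

end Exponent

/-! ### Global divisibility and integrality of the exponents -/

section Divisibility

variable {k : Type*} [Field k] [NumberField k]

theorem smul_det_sq {m : ℕ} (s : Fin m → Emb k) (x : Fin m → 𝓞 k) (g : galoisGroup k) :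
    g • (Matrix.of fun i j => intEmb (s i) (x j)).det ^ 2 =
      (Matrix.of fun i j => intEmb (g • s i) (x j)).det ^ 2 := by
  have h := RingHom.map_det (MulSemiringAction.toRingHom (galoisGroup k) (𝓞 (galoisHull k)) g)
    (Matrix.of fun i j => intEmb (s i) (x j))
  rw [smul_pow']
  exact congrArg (· ^ 2) h

/-- The inclusion of the integers of the hull into the algebraic closure. -/
noncomputable def hullIntegersToClosure (k : Type*) [Field k] [NumberField k] :
    𝓞 (galoisHull k) →+* AlgebraicClosure ℚ :=
  (galoisHull k).val.toRingHom.comp (algebraMap (𝓞 (galoisHull k)) (galoisHull k))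

theorem detSq_translate {m : ℕ} (S : Finset (Emb k)) (X : Finset (𝓞 k)) (hS : S.card = m)
    (hX : X.card = m) (g : galoisGroup k) :
    detSq (translate g S) X ((card_translate g S).trans hS) hX =
      hullIntegersToClosure k
        (g • (Matrix.of fun i j => intEmb ((S.equivFinOfCardEq hS).symm i : Emb k)
          ((X.equivFinOfCardEq hX).symm j : 𝓞 k)).det ^ 2) := by
  rw [detSq_eq _ _ _ _ ((S.equivFinOfCardEq hS).symm.trans
    ((MulAction.toPerm g).subtypeEquiv fun σ => by simp [translate]))
    (X.equivFinOfCardEq hX).symm, smul_det_sq, map_pow, RingHom.map_det]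
  rfl

/-- The product of the squared determinants over the Galois group is an integer. -/
theorem exists_int_eq_prod_smul (D : 𝓞 (galoisHull k)) :
    ∃ N : ℤ, (N : 𝓞 (galoisHull k)) = ∏ g : galoisGroup k, g • D := by
  obtain ⟨N, hN⟩ := Algebra.IsInvariant.isInvariant (A := ℤ) (G := galoisGroup k)
    (∏ g : galoisGroup k, g • D) fun h => by
      rw [Finset.smul_prod']
      exact Fintype.prod_equiv (Equiv.mulLeft h) _ _ fun g => by simp [mul_smul]
  exact ⟨N, by simpa using hN⟩

/-- Reduces both divisibility claims to the inequality `hab` between exponents, tested on prime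
powers with one `P` above each `p`. -/
theorem dvd_of_exponent_le {m : ℕ} (S : Finset (Emb k)) (hS : S.card = m) {𝔫 : Ideal (𝓞 k)}
    (h𝔫 : 𝔫 ≠ ⊥) (x : Fin m → 𝓞 k) (hx : ∀ j, x j ∈ 𝔫) (N : ℤ)
    (hN : (N : 𝓞 (galoisHull k)) = ∏ g : galoisGroup k,
      g • (Matrix.of fun i j => intEmb ((S.equivFinOfCardEq hS).symm i : Emb k) (x j)).det ^ 2)
    (a b : ℕ)
    (hab : ∀ (p : Nat.Primes) (P : Ideal (𝓞 (galoisHull k))) (_ : P.IsPrime)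
      (_ : P.LiesOver (Ideal.span {((p : ℕ) : ℤ)})),
      Nat.card (P.inertia (galoisGroup k)) *
        (a * (Module.finrank ℚ k - inertiaSum k p) + b * normExponent 𝔫 p) ≤
          ∑ g : galoisGroup k, translateExponent P 𝔫 S g) :
    (tameDiscr k : ℤ) ^ a * (Ideal.absNorm 𝔫 : ℤ) ^ b ∣ N := by
  have hnorm0 : Ideal.absNorm 𝔫 ≠ 0 := Ideal.absNorm_eq_zero_iff.not.mpr h𝔫
  rw [← Nat.cast_pow, ← Nat.cast_pow, ← Nat.cast_mul, Int.natCast_dvd,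
    Nat.dvd_iff_prime_pow_dvd_dvd]
  intro p r hp hr
  rw [← Int.natCast_dvd, Nat.cast_pow]
  have hpZ : Prime (p : ℤ) := Nat.prime_iff_prime_int.mp hp
  have : (Ideal.span {(p : ℤ)}).IsPrime := (Ideal.span_singleton_prime hpZ.ne_zero).mpr hpZ
  obtain ⟨⟨P, hPprime, hPp⟩⟩ :=
    (inferInstance : Nonempty ((Ideal.span {(p : ℤ)}).primesOver (𝓞 (galoisHull k))))
  have hP : P ≠ ⊥ := Ideal.ne_bot_of_liesOver_of_ne_bot (by simpa using hp.ne_zero :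
    Ideal.span {(p : ℤ)} ≠ ⊥) P
  have hmem : (N : 𝓞 (galoisHull k)) ∈ P ^ ∑ g : galoisGroup k, translateExponent P 𝔫 S g := by
    rw [hN, ← Finset.prod_pow_eq_pow_sum]
    refine Ideal.prod_mem_prod fun g _ => ?_
    rw [smul_det_sq]
    have h := det_sq_intEmb_mem P hP 𝔫
      (s := fun i => g • ((S.equivFinOfCardEq hS).symm i : Emb k))
      ((MulAction.injective g).comp (Subtype.val_injective.comp (Equiv.injective _))) hx
    have hsum (f : Emb k → ℕ) :
        ∑ i, f ((S.equivFinOfCardEq hS).symm i : Emb k) = ∑ σ ∈ S, f σ :=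
      (Equiv.sum_comp (S.equivFinOfCardEq hS).symm fun σ : S => f σ).trans
        (Finset.sum_coe_sort S f)
    rw [hsum fun σ => 2 * (relRamification P (g • σ) * idealOrd P 𝔫 (g • σ)),
      Finset.sum_congr rfl fun i _ => hsum fun τ =>
        embWeight P (g • ((S.equivFinOfCardEq hS).symm i : Emb k)) (g • τ),
      hsum fun σ => ∑ τ ∈ S, embWeight P (g • σ) (g • τ)] at h
    exact h
  refine pow_dvd_of_mem_pow (G := galoisGroup k) P hp N hmem
    ((Nat.mul_le_mul_left _ ?_).trans (hab ⟨p, hp⟩ P hPprime hPp))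
  have hle := (hp.pow_dvd_iff_le_factorization (mul_ne_zero (pow_ne_zero _ tameDiscr_ne_zero)
    (pow_ne_zero _ hnorm0))).mp hr
  rw [Nat.factorization_mul (pow_ne_zero _ tameDiscr_ne_zero) (pow_ne_zero _ hnorm0),
    Nat.factorization_pow, Nat.factorization_pow, Finsupp.add_apply, Finsupp.smul_apply,
    Finsupp.smul_apply, smul_eq_mul, smul_eq_mul,
    factorization_tameDiscr (k := k) ⟨p, hp⟩] at hle
  exact hle.trans (Nat.add_le_add_left (Nat.mul_le_mul_left _
    (factorization_absNorm_le h𝔫 p (primesAbove k p) fun _ => mem_primesAbove)) _)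

/-- The averaging identity applied to the indicator function of one embedding. -/
theorem finrank_dvd_card_galoisGroup : Module.finrank ℚ k ∣ Fintype.card (galoisGroup k) := by
  classical
  obtain ⟨σ⟩ : Nonempty (Emb k) := by
    rw [← Fintype.card_pos_iff, card_emb]
    exact Module.finrank_pos
  have h := card_mul_sum_smul (G := galoisGroup k) exists_smul_eq (fun τ => if τ = σ then 1 else 0) σ
  rw [card_emb] at h
  exact ⟨_, by simpa using h.symm⟩

theorem finrank_mul_dvd_two_mul_card_galoisGroup (hd : 1 < Module.finrank ℚ k)
    (h : IsTwoHomogeneous k) :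
    Module.finrank ℚ k * (Module.finrank ℚ k - 1) ∣ Fintype.card (galoisGroup k) * 2 := by
  classical
  rw [← card_emb (k := k)] at hd
  obtain ⟨σ, τ, hστ⟩ := Fintype.one_lt_card_iff.mp hd
  have h := card_mul_sum_smul_smul (exists_smul_pair h)
    -- The indicator of the unordered pair `{σ, τ}`, of total weight 2.
    (fun σ' τ' => (if σ' = σ ∧ τ' = τ then 1 else 0) + if σ' = τ ∧ τ' = σ then 1 else 0)
    (fun σ' => by
      have h1 : ¬(σ' = σ ∧ σ' = τ) := fun h => hστ (h.1.symm.trans h.2)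
      have h2 : ¬(σ' = τ ∧ σ' = σ) := fun h => h1 h.symm
      simp [h1, h2])
    (fun σ' τ' => by
      rw [add_comm]
      simp only [and_comm]) hστ
  have hsum : ∑ σ', ∑ τ', ((if σ' = σ ∧ τ' = τ then 1 else 0) +
      if σ' = τ ∧ τ' = σ then 1 else 0) = 2 := by
    simp [Finset.sum_add_distrib, ite_and]
  rw [hsum, card_emb] at h
  exact ⟨_, h.symm⟩

end Divisibility

end MinorDivisibility

/-! ### Choice of the exponents -/

open MinorDivisibility in
/-- Divisibility of the product of the squared minors by the tame discriminant and the norm. -/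
theorem mainTheorem2 (k : Type*) [Field k] [NumberField k] (hd : 1 < Module.finrank ℚ k)
    (𝔫 : Ideal (𝓞 k)) (h𝔫 : 𝔫 ≠ ⊥) (m : ℕ) (hm : 1 ≤ m) (hmd : m ≤ Module.finrank ℚ k)
    (X : Finset (𝓞 k)) (hX𝔫 : ∀ x ∈ X, x ∈ 𝔫) (hX : X.card = m)
    (S : Finset (MinorDivisibility.Emb k)) (hS : S.card = m) :
    ∃ N : ℤ,
      (N : AlgebraicClosure ℚ) =
        ∏ g : MinorDivisibility.galoisGroup k,
          MinorDivisibility.detSq (MinorDivisibility.translate g S) X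
            ((MinorDivisibility.card_translate g S).trans hS) hX ∧
      (∃ a b : ℕ,
        (a : ℚ) = Nat.card (MinorDivisibility.galoisGroup k) *
          max 0 (2 * (m : ℚ) / Module.finrank ℚ k - 1) ∧
        (b : ℚ) = Nat.card (MinorDivisibility.galoisGroup k) *
          (2 * (m : ℚ) / Module.finrank ℚ k) ∧
        (MinorDivisibility.tameDiscr k : ℤ) ^ a * (Ideal.absNorm 𝔫 : ℤ) ^ b ∣ N) ∧
      (MinorDivisibility.IsTwoHomogeneous k →
        ∃ a b : ℕ,
          (a : ℚ) = Nat.card (MinorDivisibility.galoisGroup k) *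
            ((m : ℚ) * (m - 1) / (Module.finrank ℚ k * (Module.finrank ℚ k - 1))) ∧
          (b : ℚ) = Nat.card (MinorDivisibility.galoisGroup k) *
            (2 * (m : ℚ) / Module.finrank ℚ k) ∧
          (MinorDivisibility.tameDiscr k : ℤ) ^ a * (Ideal.absNorm 𝔫 : ℤ) ^ b ∣ N) := by
  have := numberField_galoisHull k
  set d := Module.finrank ℚ k with hdef
  set x : Fin m → 𝓞 k := fun j => ((X.equivFinOfCardEq hX).symm j : 𝓞 k)
  have hx (j : Fin m) : x j ∈ 𝔫 := hX𝔫 _ ((X.equivFinOfCardEq hX).symm j).2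
  obtain ⟨N, hN⟩ := exists_int_eq_prod_smul (k := k)
    ((Matrix.of fun i j => intEmb ((S.equivFinOfCardEq hS).symm i : Emb k) (x j)).det ^ 2)
  have hdvd := dvd_of_exponent_le S hS h𝔫 x hx N hN
  obtain ⟨c, hc⟩ := finrank_dvd_card_galoisGroup (k := k)
  rw [← hdef] at hc
  have hd0 : (d : ℚ) ≠ 0 := by positivity
  have hb : ((c * (2 * m) : ℕ) : ℚ) = Nat.card (galoisGroup k) * (2 * (m : ℚ) / d) := by
    rw [Nat.card_eq_fintype_card, hc]
    push_cast
    field_simp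
  have hsplit (P : Ideal (𝓞 (galoisHull k))) :
      ∑ g : galoisGroup k, translateExponent P 𝔫 S g =
        (∑ g : galoisGroup k,
          ∑ σ ∈ S, 2 * (relRamification P (g • σ) * idealOrd P 𝔫 (g • σ))) +
        ∑ g : galoisGroup k, ∑ σ ∈ S, ∑ τ ∈ S, embWeight P (g • σ) (g • τ) :=
    Finset.sum_add_distrib
  have hord (p : Nat.Primes) (P : Ideal (𝓞 (galoisHull k))) (_ : P.IsPrime)
      (_ : P.LiesOver (Ideal.span {((p : ℕ) : ℤ)})) :
      ∑ g : galoisGroup k,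
          ∑ σ ∈ S, 2 * (relRamification P (g • σ) * idealOrd P 𝔫 (g • σ)) =
        Nat.card (P.inertia (galoisGroup k)) * (c * (2 * m) * normExponent 𝔫 p) := by
    refine Nat.eq_of_mul_eq_mul_left (show 0 < d by omega) ?_
    rw [hdef, finrank_mul_sum_idealOrd P 𝔫 p S, hS, hc]
    ring
  -- With `|G| = d * c` these are the required exponents; the natural subtraction is 0 when `2 * m ≤
  -- d`.
  refine ⟨N, ?_, ⟨c * (2 * m - d), c * (2 * m), ?_, hb, hdvd _ _ ?_⟩, fun htwo => ?_⟩
  · rw [Finset.prod_congr rfl fun g _ => detSq_translate S X hS hX g, ← map_prod, ← hN,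
      map_intCast]
  · rw [Nat.card_eq_fintype_card, hc]
    rcases le_total d (2 * m) with h | h
    · have h' : (d : ℚ) ≤ 2 * m := by exact_mod_cast h
      rw [max_eq_right (by rw [sub_nonneg, one_le_div (by positivity)]; exact h')]
      push_cast [Nat.cast_sub h]
      field_simp
    · have h' : 2 * (m : ℚ) ≤ d := by exact_mod_cast h
      rw [max_eq_left (by rw [sub_nonpos, div_le_one (by positivity)]; exact h'),
        Nat.sub_eq_zero_of_le h]
      simp
  · intro p P hPprime hPp
    rw [hsplit, hord p P hPprime hPp, mul_add, add_comm]
    refine Nat.add_le_add_left (Nat.le_of_mul_le_mul_left ?_ (show 0 < d by omega)) _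
    refine le_trans (le_of_eq ?_) (le_finrank_mul_sum_embWeight P p S)
    rw [hS, hc, ← hdef]
    ring
  · obtain ⟨e, he⟩ := finrank_mul_dvd_two_mul_card_galoisGroup hd htwo
    rw [← hdef] at he
    -- Only `2 * |G|` is known to be divisible by `d * (d - 1)`; the factor 2 comes from `m * (m -
    -- 1)`.
    obtain ⟨t, ht⟩ : 2 ∣ m * (m - 1) := (Nat.even_mul_pred_self m).two_dvd
    have he' : Fintype.card (galoisGroup k) * (m * (m - 1)) = d * (d - 1) * (e * t) := by
      rw [ht, ← mul_assoc, he, mul_assoc]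
    refine ⟨e * t, c * (2 * m), ?_, hb, hdvd _ _ ?_⟩
    · have hcast : (Nat.card (galoisGroup k) : ℚ) * (m * (m - 1)) =
          d * (d - 1) * ((e * t : ℕ) : ℚ) := by
        have := congrArg (Nat.cast : ℕ → ℚ) he'
        push_cast [Nat.cast_sub hm, Nat.cast_sub hd.le] at this
        rw [Nat.card_eq_fintype_card]
        push_cast
        exact this
      have hd1 : (d : ℚ) - 1 ≠ 0 := by
        rw [sub_ne_zero]
        exact_mod_cast hd.ne'
      rw [← mul_div_assoc, hcast]
      field_simp
    · intro p P hPprime hPp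
      rw [hsplit, hord p P hPprime hPp, mul_add, add_comm]
      refine Nat.add_le_add_left (le_of_eq ?_) _
      refine Nat.eq_of_mul_eq_mul_left (show 0 < d * (d - 1) from Nat.mul_pos (by omega)
        (by omega)) ?_
      rw [hdef, finrank_mul_sum_embWeight P p S htwo, hS, ← hdef,
        ← mul_assoc (Fintype.card (galoisGroup k)), he']
      ring
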